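/- Let $\mathcal{X}$ be a unital $C^*$-algebra, $\mathcal{M}$ a von Neumann algebra on a Hilbert space $\mathcal{H}$, and let $\mathrm{CP}(\mathcal{X},\mathcal{M})$ be the set of completely positive maps $\mathcal{X}\to B(\mathcal{H})$ with values in $\mathcal{M}$. Let $T\in\mathrm{CP}(\mathcal{X},\mathcal{M})$ and let $(\pi_T,\mathcal{K}_T,V_T)$ be a minimal Stinespring representation of $T$: $\pi_T$ is a $^*$-representation of $\mathcal{X}$ on the Hilbert space $\mathcal{K}_T$, $V_T\in B(\mathcal{H},\mathcal{K}_T)$, $T(X)=V_T^*\pi_T(X)V_T$ for all $X\in\mathcal{X}$, and $\mathcal{K}_T=\overline{\mathrm{span}}(\pi_T(\mathcal{X})V_T\mathcal{H})$. For $R\in\pi_T(\mathcal{X})'$ with $0\le R\le 1$ put $T_R(X)=V_T^*R\pi_T(X)V_T$, $X\in\mathcal{X}$. Let $\pi_T(\mathcal{X})^c\subseteq B(\mathcal{K}_T)$ (the $\mathcal{M}$-relative commutant of $\pi_T(\mathcal{X})$) be the $\sigma$-weak closure of the linear span of $$\{R\in\pi_T(\mathcal{X})' \mid 0\le R\le 1,\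 T_R\in\mathrm{CP}(\mathcal{X},\mathcal{M})\}.$$ Then $\pi_T(\mathcal{X})^c$ is a von Neumann algebra on $\mathcal{K}_T$. -/

import Mathlib

open scoped CStarAlgebra InnerProductSpace

/-- `CP(𝒳, ℳ)`: the completely positive maps from `𝒳` to `B(H)` whose values lie in the
von Neumann algebra `ℳ` on `H`. -/
def CPMapsInto (𝒳 : Type*) [CStarAlgebra 𝒳] [PartialOrder 𝒳] [StarOrderedRing 𝒳]
    {H : Type*} [NormedAddCommGroup H] [InnerProductSpace ℂ H] [CompleteSpace H]
    (ℳ : VonNeumannAlgebra H) : Set (𝒳 →CP (H →L[ℂ] H)) :=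
  {T | ∀ x, T x ∈ ℳ}

/-- `(π, K, V)` is a minimal Stinespring representation of `T`: `T x = V* π(x) V` for all `x`,
and `K` is the closed linear span of `π(𝒳) V H`. -/
structure IsMinimalStinespring {𝒳 : Type*} [CStarAlgebra 𝒳] [PartialOrder 𝒳] [StarOrderedRing 𝒳]
    {H : Type*} [NormedAddCommGroup H] [InnerProductSpace ℂ H] [CompleteSpace H]
    {K : Type*} [NormedAddCommGroup K] [InnerProductSpace ℂ K] [CompleteSpace K]
    (T : 𝒳 →CP (H →L[ℂ] H)) (π : 𝒳 →⋆ₐ[ℂ] (K →L[ℂ] K)) (V : H →L[ℂ] K) : Prop where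
  map_eq : ∀ x, T x = V.adjoint ∘L π x ∘L V
  dense_span :
    (Submodule.span ℂ {k : K | ∃ (x : 𝒳) (h : H), k = π x (V h)}).topologicalClosure = ⊤

/-- The σ-weak (ultraweak) topology on `B(K)`: the coarsest topology that makes all functionals
`A ↦ ∑ₙ ⟪ξₙ, A ηₙ⟫` with `∑ₙ ‖ξₙ‖² < ∞` and `∑ₙ ‖ηₙ‖² < ∞` (equivalently, all functionals
`A ↦ Tr(σ A)` with `σ` of trace class) continuous. -/
@[reducible] noncomputable def sigmaWeakTopology (K : Type*) [NormedAddCommGroup K] [InnerProductSpace ℂ K] :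
    TopologicalSpace (K →L[ℂ] K) :=
  ⨅ (ξ : ℕ → K) (η : ℕ → K) (_ : Summable fun n => ‖ξ n‖ ^ 2) (_ : Summable fun n => ‖η n‖ ^ 2),
    TopologicalSpace.induced (fun A : K →L[ℂ] K => ∑' n, ⟪ξ n, A (η n)⟫_ℂ) inferInstance

/-- The operators `R ∈ π(𝒳)'` with `0 ≤ R ≤ 1` such that the map `x ↦ V* R π(x) V` belongs to
`CP(𝒳, ℳ)`. -/
def relativeEffects {𝒳 : Type*} [CStarAlgebra 𝒳] [PartialOrder 𝒳] [StarOrderedRing 𝒳]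
    {H : Type*} [NormedAddCommGroup H] [InnerProductSpace ℂ H] [CompleteSpace H]
    {K : Type*} [NormedAddCommGroup K] [InnerProductSpace ℂ K] [CompleteSpace K]
    (ℳ : VonNeumannAlgebra H) (π : 𝒳 →⋆ₐ[ℂ] (K →L[ℂ] K)) (V : H →L[ℂ] K) :
    Set (K →L[ℂ] K) :=
  {R | R ∈ Set.centralizer (Set.range π) ∧ 0 ≤ R ∧ R ≤ 1 ∧
    ∃ T' ∈ CPMapsInto 𝒳 ℳ, ∀ x, T' x = V.adjoint ∘L R ∘L π x ∘L V}

/-- The `ℳ`-relative commutant `π(𝒳)ᶜ`: the σ-weak closure of the linear span of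
`relativeEffects ℳ π V`. -/
def relativeCommutant {𝒳 : Type*} [CStarAlgebra 𝒳] [PartialOrder 𝒳] [StarOrderedRing 𝒳]
    {H : Type*} [NormedAddCommGroup H] [InnerProductSpace ℂ H] [CompleteSpace H]
    {K : Type*} [NormedAddCommGroup K] [InnerProductSpace ℂ K] [CompleteSpace K]
    (ℳ : VonNeumannAlgebra H) (π : 𝒳 →⋆ₐ[ℂ] (K →L[ℂ] K)) (V : H →L[ℂ] K) :
    Set (K →L[ℂ] K) :=
  @closure _ (sigmaWeakTopology K)
    (Submodule.span ℂ (relativeEffects ℳ π V) : Set (K →L[ℂ] K))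

/-!
Every unitary `u ∈ ℳ'` commutes with the compressions `V* π(x) V = T x ∈ ℳ`, so
`π(x) V h ↦ π(x) V u h` preserves inner products and extends to an operator `B ∈ π(𝒳)'` with
`B V = V u` and `V* B = u V*`. An operator `R ∈ π(𝒳)'` commutes with all these lifts if and only if
all compressions `V* R π(x) V` commute with `ℳ'`, that is, lie in `ℳ'' = ℳ`. Hence the relative
effects are exactly the effects of a von Neumann algebra, namely the commutant of `π(𝒳)` together
with the lifts. A von Neumann algebra is the linear span of its effects and is σ-weakly closed, so
the closure of the span gives back this algebra.

That `x ↦ V* R π(x) V` is completely positive for each effect `R ∈ π(𝒳)'` follows by writing it as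
`W* π(x) W` with `W = √R V`.
-/

open scoped InnerProduct

section ColumnCriterion

theorem eq_zero_of_isSelfAdjoint_of_mul_mul_self_eq_zero {A : Type*} [NonUnitalNormedRing A]
    [StarRing A] [CStarRing A] {a : A} (ha : IsSelfAdjoint a) (h : a * a * a = 0) : a = 0 := by
  have eq_zero_of_mul_self {b : A} (hb : IsSelfAdjoint b) (hbb : b * b = 0) : b = 0 := by
    rwa [← CStarRing.star_mul_self_eq_zero_iff, hb.star_eq]
  have haa : IsSelfAdjoint (a * a) := by simpa only [ha.star_eq] using IsSelfAdjoint.star_mul_self a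
  exact eq_zero_of_mul_self ha (eq_zero_of_mul_self haa (by rw [← mul_assoc, h, zero_mul]))

variable {A : Type*} [NonUnitalCStarAlgebra A]

theorem negPart_mul_mul_negPart {a : A} (ha : IsSelfAdjoint a) :
    a⁻ * a * a⁻ = -(a⁻ * a⁻ * a⁻) := by
  nth_rw 2 [← CFC.posPart_sub_negPart a ha]
  rw [mul_sub, CFC.negPart_mul_posPart, zero_sub, neg_mul]

variable [PartialOrder A] [StarOrderedRing A] {n : Type*} [Fintype n]

theorem cstarMatrix_eq_zero_of_nonneg_of_diag_nonpos {P : CStarMatrix n n A} (hP : 0 ≤ P)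
    (hdiag : ∀ l, P l l ≤ 0) : P = 0 := by
  -- Instance search finds the entrywise real structure, whereas the functional calculus uses the
  -- one obtained by restricting scalars from `ℂ`.
  let _ : Module ℝ (CStarMatrix n n A) := NormedSpace.complexToReal.toModule
  obtain ⟨c, rfl⟩ := CStarAlgebra.nonneg_iff_eq_star_mul_self.1 hP
  suffices hc : c = 0 by rw [hc, mul_zero]
  ext k l
  have hsum : ∑ i, star (c i l) * c i l = 0 :=
    (hdiag l).antisymm (Finset.sum_nonneg fun i _ => star_mul_self_nonneg (c i l))
  exact (CStarRing.star_mul_self_eq_zero_iff _).1 <|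
    (Finset.sum_eq_zero_iff_of_nonneg fun i _ => star_mul_self_nonneg (c i l)).1 hsum k
      (Finset.mem_univ k)

theorem cstarMatrix_nonneg_of_sum_star_mul_mul_nonneg {M : CStarMatrix n n A}
    (hM : IsSelfAdjoint M) (h : ∀ v : n → A, 0 ≤ ∑ i, ∑ j, star (v i) * M i j * v j) : 0 ≤ M := by
  let _ : Module ℝ (CStarMatrix n n A) := NormedSpace.complexToReal.toModule
  -- Testing `h` on the columns of `M⁻` gives the diagonal of `M⁻ M M⁻ = -(M⁻)³`.
  have hneg : 0 ≤ M⁻ := CFC.negPart_nonneg M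
  have hcube : 0 ≤ M⁻ * M⁻ * M⁻ := by
    simpa only [hneg.isSelfAdjoint.star_eq] using star_left_conjugate_nonneg hneg M⁻
  have hdiag (l : n) : (M⁻ * M⁻ * M⁻) l l ≤ 0 := by
    rw [← neg_nonneg, ← CStarMatrix.neg_apply, ← negPart_mul_mul_negPart hM]
    nth_rw 1 [← hneg.isSelfAdjoint.star_eq]
    simp only [CStarMatrix.mul_apply, CStarMatrix.star_apply, Finset.sum_mul]
    rw [Finset.sum_comm]
    exact h fun i => M⁻ i l
  exact (CFC.negPart_eq_zero_iff M hM).1 <|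
    eq_zero_of_isSelfAdjoint_of_mul_mul_self_eq_zero hneg.isSelfAdjoint <|
      cstarMatrix_eq_zero_of_nonneg_of_diag_nonpos hcube hdiag

end ColumnCriterion

section Compression

variable {H : Type*} [NormedAddCommGroup H] [InnerProductSpace ℂ H] [CompleteSpace H]
  {K : Type*} [NormedAddCommGroup K] [InnerProductSpace ℂ K] [CompleteSpace K]

theorem sum_star_mul_compression_mul_nonneg {n : Type*} [Fintype n] (W : H →L[ℂ] K)
    {M : CStarMatrix n n (K →L[ℂ] K)} (hM : 0 ≤ M) (v : n → H →L[ℂ] H) :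
    0 ≤ ∑ i, ∑ j, star (v i) * (W† ∘L M i j ∘L W) * v j := by
  let _ : Module ℝ (CStarMatrix n n (K →L[ℂ] K)) := NormedSpace.complexToReal.toModule
  obtain ⟨N, rfl⟩ := CStarAlgebra.nonneg_iff_eq_star_mul_self.1 hM
  have hsquares : ∑ i, ∑ j, star (v i) * (W† ∘L (star N * N) i j ∘L W) * v j =
      ∑ l, (∑ i, N l i ∘L W ∘L v i)† ∘L ∑ j, N l j ∘L W ∘L v j := by
    have hterm (i j l : n) : star (v i) * (W† ∘L (star (N l i) * N l j) ∘L W) * v j =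
        (N l i ∘L W ∘L v i)† ∘L N l j ∘L W ∘L v j := by
      simp only [ContinuousLinearMap.adjoint_comp]
      rfl
    simp only [CStarMatrix.mul_apply, CStarMatrix.star_apply, ContinuousLinearMap.finsetSum_comp,
      ContinuousLinearMap.comp_finsetSum, map_sum, Finset.mul_sum, Finset.sum_mul, hterm]
    conv_rhs => rw [Finset.sum_comm]
    rw [Finset.sum_comm]
    exact Finset.sum_congr rfl fun i _ => Finset.sum_comm
  rw [hsquares]
  refine Finset.sum_nonneg fun l _ => ?_
  rw [ContinuousLinearMap.nonneg_iff_isPositive]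
  exact ContinuousLinearMap.isPositive_adjoint_comp_self _

/-- The compression `A ↦ W* A W` as a completely positive map. -/
noncomputable def compressionCP (W : H →L[ℂ] K) : (K →L[ℂ] K) →CP (H →L[ℂ] H) where
  toFun A := W† ∘L A ∘L W
  map_add' A B := by simp only [ContinuousLinearMap.add_comp, ContinuousLinearMap.comp_add]
  map_smul' c A := by
    simp only [ContinuousLinearMap.smul_comp, ContinuousLinearMap.comp_smul, RingHom.id_apply]
  map_cstarMatrix_nonneg' k M hM := by
    refine cstarMatrix_nonneg_of_sum_star_mul_mul_nonneg ?_
      (sum_star_mul_compression_mul_nonneg W hM)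
    ext i j : 2
    have hMij : (M j i)† = M i j := CStarMatrix.star_apply_of_isSelfAdjoint hM.isSelfAdjoint
    simp only [CStarMatrix.star_apply, CStarMatrix.map_apply, LinearMap.coe_mk, AddHom.coe_mk,
      ContinuousLinearMap.star_eq_adjoint, ContinuousLinearMap.adjoint_comp,
      ContinuousLinearMap.adjoint_adjoint, hMij, ContinuousLinearMap.comp_assoc]

variable {𝒳 : Type*} [CStarAlgebra 𝒳] [PartialOrder 𝒳] [StarOrderedRing 𝒳]

/-- The completely positive map `x ↦ W* π(x) W` with Stinespring data `(π, W)`, where the closed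
span of `π(𝒳) W H` need not be all of `K`. -/
noncomputable def stinespringCP (π : 𝒳 →⋆ₐ[ℂ] (K →L[ℂ] K)) (W : H →L[ℂ] K) :
    𝒳 →CP (H →L[ℂ] H) where
  toLinearMap := (compressionCP W).toLinearMap ∘ₗ π.toAlgHom.toLinearMap
  map_cstarMatrix_nonneg' k M hM := (compressionCP W).map_cstarMatrix_nonneg (M.map π)
    (CompletelyPositiveMapClass.map_cstarMatrix_nonneg' π k M hM)

theorem exists_completelyPositive_eq_of_mem_centralizer (π : 𝒳 →⋆ₐ[ℂ] (K →L[ℂ] K))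
    (V : H →L[ℂ] K) {R : K →L[ℂ] K} (hR : R ∈ (Set.range π).centralizer) (hR0 : 0 ≤ R) :
    ∃ T' : 𝒳 →CP (H →L[ℂ] H), ∀ x, T' x = V† ∘L R ∘L π x ∘L V := by
  refine ⟨stinespringCP π (CFC.sqrt R ∘L V), fun x => ?_⟩
  have hcomm : Commute (CFC.sqrt R) (π x) :=
    Commute.cfcₙ_nnreal (hR (π x) ⟨x, rfl⟩).symm NNReal.sqrt
  have hsqrt : (CFC.sqrt R)† = CFC.sqrt R := (CFC.sqrt_nonneg R).isSelfAdjoint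
  calc (CFC.sqrt R ∘L V)† ∘L π x ∘L CFC.sqrt R ∘L V
      = V† ∘L CFC.sqrt R ∘L (π x * CFC.sqrt R) ∘L V := by
        rw [ContinuousLinearMap.adjoint_comp, hsqrt]; rfl
    _ = V† ∘L (CFC.sqrt R * CFC.sqrt R) ∘L π x ∘L V := by rw [← hcomm.eq]; rfl
    _ = V† ∘L R ∘L π x ∘L V := by rw [CFC.sqrt_mul_sqrt_self R]

end Compression

section GramIsometry

variable {𝕜 E F ι : Type*} [RCLike 𝕜] [NormedAddCommGroup E] [InnerProductSpace 𝕜 E]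
  [NormedAddCommGroup F] [InnerProductSpace 𝕜 F]

theorem norm_linearCombination_eq_of_inner_eq {v : ι → E} {w : ι → F}
    (h : ∀ i j, inner 𝕜 (w i) (w j) = inner 𝕜 (v i) (v j)) (c : ι →₀ 𝕜) :
    ‖Finsupp.linearCombination 𝕜 w c‖ = ‖Finsupp.linearCombination 𝕜 v c‖ := by
  rw [@norm_eq_sqrt_re_inner 𝕜, @norm_eq_sqrt_re_inner 𝕜]
  simp only [Finsupp.linearCombination_apply, Finsupp.sum, sum_inner, inner_sum, inner_smul_left,
    inner_smul_right, h]

theorem exists_linearIsometry_of_inner_eq [CompleteSpace F] {v : ι → E} {w : ι → F}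
    (hv : Dense (Submodule.span 𝕜 (Set.range v) : Set E))
    (h : ∀ i j, inner 𝕜 (w i) (w j) = inner 𝕜 (v i) (v j)) :
    ∃ U : E →ₗᵢ[𝕜] F, ∀ i, U (v i) = w i := by
  let e := Finsupp.linearCombination 𝕜 v
  let f := Finsupp.linearCombination 𝕜 w
  have hnorm : ∀ c, ‖f c‖ = ‖e c‖ := norm_linearCombination_eq_of_inner_eq h
  have he : DenseRange e := by
    rwa [DenseRange, ← LinearMap.coe_range, Finsupp.range_linearCombination]
  have hext : ∀ c, f.extendOfNorm e (e c) = f c :=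
    LinearMap.extendOfNorm_eq he ⟨1, fun c => by rw [hnorm, one_mul]⟩
  refine ⟨⟨(f.extendOfNorm e).toLinearMap, fun x => ?_⟩, fun i => ?_⟩
  · refine he.induction_on (p := fun x => ‖f.extendOfNorm e x‖ = ‖x‖) x
      (isClosed_eq (by fun_prop) continuous_norm) fun c => ?_
    rw [hext, hnorm]
  · simpa [e, f] using hext (Finsupp.single i 1)

end GramIsometry

section SigmaWeak

variable {K : Type*} [NormedAddCommGroup K] [InnerProductSpace ℂ K]

theorem continuous_inner_apply_sigmaWeakTopology (ξ η : K) :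
    @Continuous _ _ (sigmaWeakTopology K) _ fun A : K →L[ℂ] K => ⟪ξ, A η⟫_ℂ := by
  have hsum (ζ : K) : Summable fun n : ℕ => ‖(Pi.single 0 ζ : ℕ → K) n‖ ^ 2 :=
    summable_of_ne_finset_zero (s := {0}) fun n hn => by
      rw [Pi.single_eq_of_ne (by simpa using hn), norm_zero, zero_pow two_ne_zero]
  have heq : (fun A : K →L[ℂ] K => ⟪ξ, A η⟫_ℂ) = fun A : K →L[ℂ] K =>
      ∑' n, ⟪(Pi.single 0 ξ : ℕ → K) n, A ((Pi.single 0 η : ℕ → K) n)⟫_ℂ := by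
    funext A
    rw [tsum_eq_single 0 fun n hn => by rw [Pi.single_eq_of_ne hn, inner_zero_left],
      Pi.single_eq_same, Pi.single_eq_same]
  rw [heq, continuous_iff_le_induced]
  exact iInf₂_le_of_le _ _ <| iInf₂_le_of_le (hsum ξ) (hsum η) le_rfl

variable [CompleteSpace K]

theorem isClosed_sigmaWeakTopology_centralizer (S : Set (K →L[ℂ] K)) :
    @IsClosed _ (sigmaWeakTopology K) S.centralizer := by
  have hS : S.centralizer = ⋂ B ∈ S, ⋂ ξ : K, ⋂ η : K,
      {A : K →L[ℂ] K | ⟪(B†) ξ, A η⟫_ℂ = ⟪ξ, A (B η)⟫_ℂ} := by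
    ext A
    simp only [Set.mem_iInter, Set.mem_ofPred_eq, Set.mem_centralizer_iff,
      ContinuousLinearMap.adjoint_inner_left]
    refine forall₂_congr fun B _ => ⟨fun h ξ η => ?_, fun h => ?_⟩
    · exact congrArg _ (DFunLike.congr_fun h η)
    · ext η
      exact ext_inner_left ℂ fun ξ => h ξ η
  rw [hS]
  let _ := sigmaWeakTopology K
  exact isClosed_biInter fun B _ => isClosed_iInter fun ξ => isClosed_iInter fun η =>
    isClosed_eq (continuous_inner_apply_sigmaWeakTopology _ _)
      (continuous_inner_apply_sigmaWeakTopology _ _)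

end SigmaWeak

section Span

theorem mem_span_image_coe_of_span_eq_top {R A : Type*} [CommSemiring R] [StarRing R] [Semiring A]
    [StarRing A] [Algebra R A] [StarModule R A] (𝒜 : StarSubalgebra R A) {s : Set 𝒜}
    (hs : Submodule.span R s = ⊤) {a : A} (ha : a ∈ 𝒜) :
    a ∈ Submodule.span R ((↑) '' s : Set A) := by
  have h := Submodule.mem_map_of_mem (f := 𝒜.subtype.toAlgHom.toLinearMap)
    (hs ▸ Submodule.mem_top : (⟨a, ha⟩ : 𝒜) ∈ Submodule.span R s)
  rwa [Submodule.map_span] at h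

theorem span_star_mul_self_inter_closedBall {A : Type*} [CStarAlgebra A] :
    Submodule.span ℂ (Set.range (fun c : A => star c * c) ∩ Metric.closedBall 0 1) = ⊤ := by
  let _ := CStarAlgebra.spectralOrder A
  have := CStarAlgebra.spectralOrderedRing A
  rw [← CStarAlgebra.span_nonneg_inter_unitClosedBall]
  congr 2
  ext x
  exact ⟨fun ⟨c, hc⟩ => hc ▸ star_mul_self_nonneg c, fun hx =>
    (CStarAlgebra.nonneg_iff_eq_star_mul_self.1 hx).imp fun _ => Eq.symm⟩

end Span

section VonNeumann

variable {H : Type*} [NormedAddCommGroup H] [InnerProductSpace ℂ H] [CompleteSpace H]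
  (ℳ : VonNeumannAlgebra H)

theorem isClosed_coe_vonNeumannAlgebra : IsClosed (ℳ : Set (H →L[ℂ] H)) := by
  rw [← VonNeumannAlgebra.centralizer_centralizer]
  exact Set.isClosed_centralizer _

theorem isClosed_sigmaWeakTopology_coe_vonNeumannAlgebra :
    @IsClosed _ (sigmaWeakTopology H) (ℳ : Set (H →L[ℂ] H)) := by
  rw [← VonNeumannAlgebra.centralizer_centralizer]
  exact isClosed_sigmaWeakTopology_centralizer _

theorem exists_vonNeumannAlgebra_coe_eq_centralizer {S : Set (H →L[ℂ] H)}
    (hS : ∀ B ∈ S, star B ∈ S) :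
    ∃ N : VonNeumannAlgebra H, (N : Set (H →L[ℂ] H)) = S.centralizer := by
  have hstar : star S = S := Set.Subset.antisymm
    (fun B hB => star_star B ▸ hS _ hB) fun B hB => hS B hB
  have hcoe : (StarSubalgebra.centralizer ℂ S).carrier = S.centralizer := by
    change (S ∪ star S).centralizer = S.centralizer
    rw [hstar, Set.union_self]
  exact ⟨⟨StarSubalgebra.centralizer ℂ S, by
    rw [hcoe, Set.centralizer_centralizer_centralizer]⟩, hcoe⟩

theorem mem_span_unitary_of_mem_vonNeumannAlgebra {a : H →L[ℂ] H} (ha : a ∈ ℳ) :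
    a ∈ Submodule.span ℂ {u | u ∈ ℳ ∧ u ∈ unitary (H →L[ℂ] H)} := by
  have : IsClosed (ℳ.toStarSubalgebra : Set (H →L[ℂ] H)) := isClosed_coe_vonNeumannAlgebra ℳ
  refine Submodule.span_mono ?_
    (mem_span_image_coe_of_span_eq_top ℳ.toStarSubalgebra (CStarAlgebra.span_unitary _) ha)
  rintro _ ⟨u, hu, rfl⟩
  exact ⟨u.2, Unitary.map_mem ℳ.toStarSubalgebra.subtype hu⟩

theorem mem_span_effects_of_mem_vonNeumannAlgebra {a : H →L[ℂ] H} (ha : a ∈ ℳ) :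
    a ∈ Submodule.span ℂ {R | R ∈ ℳ ∧ 0 ≤ R ∧ R ≤ 1} := by
  have : IsClosed (ℳ.toStarSubalgebra : Set (H →L[ℂ] H)) := isClosed_coe_vonNeumannAlgebra ℳ
  refine Submodule.span_mono ?_ (mem_span_image_coe_of_span_eq_top ℳ.toStarSubalgebra
    span_star_mul_self_inter_closedBall ha)
  rintro _ ⟨_, ⟨⟨c, rfl⟩, hc⟩, rfl⟩
  have hnonneg : 0 ≤ ((star c * c : ℳ.toStarSubalgebra) : H →L[ℂ] H) :=
    star_mul_self_nonneg (c : H →L[ℂ] H)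
  exact ⟨(star c * c).2, hnonneg, (CStarAlgebra.norm_le_one_iff_of_nonneg _ hnonneg).1
    (mem_closedBall_zero_iff.1 hc)⟩

theorem closure_sigmaWeakTopology_span_effects :
    @closure _ (sigmaWeakTopology H)
      (Submodule.span ℂ {R | R ∈ ℳ ∧ 0 ≤ R ∧ R ≤ 1} : Set (H →L[ℂ] H)) = ℳ := by
  have hspan : (Submodule.span ℂ {R | R ∈ ℳ ∧ 0 ≤ R ∧ R ≤ 1} : Set (H →L[ℂ] H)) = ℳ :=
    Set.Subset.antisymm
      (Submodule.span_le (p := ℳ.toSubalgebra.toSubmodule) |>.2 fun R hR => hR.1)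
      fun a ha => mem_span_effects_of_mem_vonNeumannAlgebra ℳ ha
  rw [hspan]
  exact @IsClosed.closure_eq _ (sigmaWeakTopology H) _
    (isClosed_sigmaWeakTopology_coe_vonNeumannAlgebra ℳ)

theorem mem_vonNeumannAlgebra_of_forall_commute_unitary {a : H →L[ℂ] H}
    (h : ∀ u ∈ ℳ.commutant, u ∈ unitary (H →L[ℂ] H) → u * a = a * u) : a ∈ ℳ := by
  rw [← ℳ.commutant_commutant, VonNeumannAlgebra.mem_commutant_iff]
  intro b hb
  have hspan : Submodule.span ℂ {u | u ∈ ℳ.commutant ∧ u ∈ unitary (H →L[ℂ] H)} ≤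
      (Subalgebra.centralizer ℂ {a}).toSubmodule :=
    Submodule.span_le.2 fun u hu => Set.mem_centralizer_iff.2 fun _ ha => by
      rw [Set.mem_singleton_iff.1 ha, h u hu.1 hu.2]
  exact (hspan (mem_span_unitary_of_mem_vonNeumannAlgebra _ hb) a rfl).symm

end VonNeumann

section CyclicMap

variable {H : Type*} [NormedAddCommGroup H] [InnerProductSpace ℂ H]
  {K : Type*} [NormedAddCommGroup K] [InnerProductSpace ℂ K] [CompleteSpace K]

/-- `V : H → K` is cyclic for the `*`-algebra `𝒜 ⊆ B(K)` if the vectors `a (V h)`, with `a ∈ 𝒜`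
and `h ∈ H`, span a dense subspace of `K`: the minimality condition on a Stinespring
representation. -/
def IsCyclicMap (𝒜 : StarSubalgebra ℂ (K →L[ℂ] K)) (V : H →L[ℂ] K) : Prop :=
  Dense (Submodule.span ℂ (Set.range fun p : 𝒜 × H => (p.1 : K →L[ℂ] K) (V p.2)) : Set K)

variable {𝒜 : StarSubalgebra ℂ (K →L[ℂ] K)} {V : H →L[ℂ] K}

namespace IsCyclicMap

theorem ext (hV : IsCyclicMap 𝒜 V) {B C : K →L[ℂ] K}
    (h : ∀ a ∈ 𝒜, B ∘L a ∘L V = C ∘L a ∘L V) : B = C := by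
  refine ContinuousLinearMap.ext_on hV ?_
  rintro _ ⟨⟨a, ξ⟩, rfl⟩
  exact DFunLike.congr_fun (h a a.2) ξ

variable [CompleteSpace H]

theorem ext_compression (hV : IsCyclicMap 𝒜 V) {B C : K →L[ℂ] K}
    (h : ∀ a ∈ 𝒜, ∀ b ∈ 𝒜, V† ∘L a ∘L B ∘L b ∘L V = V† ∘L a ∘L C ∘L b ∘L V) : B = C := by
  refine hV.ext fun b hb => ?_
  rw [← ContinuousLinearMap.adjoint_adjoint (B ∘L b ∘L V),
    ← ContinuousLinearMap.adjoint_adjoint (C ∘L b ∘L V)]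
  refine congrArg _ (ContinuousLinearMap.ext_on hV ?_)
  rintro _ ⟨⟨a, ξ⟩, rfl⟩
  refine ext_inner_left ℂ fun ζ => ?_
  have hab := congrArg (fun D : H →L[ℂ] H => ⟪D ζ, ξ⟫_ℂ) (h (star a) (star_mem a.2) b hb)
  simpa [ContinuousLinearMap.star_eq_adjoint, ContinuousLinearMap.adjoint_inner_left,
    ContinuousLinearMap.adjoint_inner_right] using hab

theorem exists_linearIsometry_lift (hV : IsCyclicMap 𝒜 V) {u : H →L[ℂ] H}
    (hu : u ∈ unitary (H →L[ℂ] H)) (hcomm : ∀ a ∈ 𝒜, u * (V† ∘L a ∘L V) = (V† ∘L a ∘L V) * u) :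
    ∃ B : K →ₗᵢ[ℂ] K, ∀ a ∈ 𝒜, ∀ ξ, B (a (V ξ)) = a (V (u ξ)) := by
  have hgram (p q : 𝒜 × H) :
      ⟪(p.1 : K →L[ℂ] K) (V (u p.2)), (q.1 : K →L[ℂ] K) (V (u q.2))⟫_ℂ =
        ⟪(p.1 : K →L[ℂ] K) (V p.2), (q.1 : K →L[ℂ] K) (V q.2)⟫_ℂ := by
    obtain ⟨⟨a, ξ⟩, ⟨b, η⟩⟩ := p, q
    let t : H →L[ℂ] H := V† ∘L (star a * b : 𝒜) ∘L V
    have hinner (ζ ω : H) :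
        ⟪(a : K →L[ℂ] K) (V ζ), (b : K →L[ℂ] K) (V ω)⟫_ℂ = ⟪ζ, t ω⟫_ℂ := by
      simp [t, ContinuousLinearMap.star_eq_adjoint, ContinuousLinearMap.adjoint_inner_right]
    calc ⟪(a : K →L[ℂ] K) (V (u ξ)), (b : K →L[ℂ] K) (V (u η))⟫_ℂ
        = ⟪u ξ, u (t η)⟫_ℂ := by
          rw [hinner]
          exact congrArg _ (DFunLike.congr_fun (hcomm _ (star a * b).2).symm η)
      _ = ⟪ξ, t η⟫_ℂ := ContinuousLinearMap.inner_map_map_of_mem_unitary hu _ _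
      _ = ⟪(a : K →L[ℂ] K) (V ξ), (b : K →L[ℂ] K) (V η)⟫_ℂ := (hinner ξ η).symm
  obtain ⟨B, hB⟩ := exists_linearIsometry_of_inner_eq hV hgram
  exact ⟨B, fun a ha ξ => hB (⟨a, ha⟩, ξ)⟩

theorem exists_lift (hV : IsCyclicMap 𝒜 V) {u : H →L[ℂ] H} (hu : u ∈ unitary (H →L[ℂ] H))
    (hcomm : ∀ a ∈ 𝒜, u * (V† ∘L a ∘L V) = (V† ∘L a ∘L V) * u) :
    ∃ B ∈ (𝒜 : Set (K →L[ℂ] K)).centralizer, B ∘L V = V ∘L u ∧ V† ∘L B = u ∘L V† := by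
  obtain ⟨U, hU⟩ := hV.exists_linearIsometry_lift hu hcomm
  let B : K →L[ℂ] K := U.toContinuousLinearMap
  have hBV : B ∘L V = V ∘L u := by
    ext ξ
    exact hU 1 (one_mem 𝒜) ξ
  have hcentral : B ∈ (𝒜 : Set (K →L[ℂ] K)).centralizer := fun a ha => hV.ext fun b hb => by
    ext ξ
    calc a (B (b (V ξ))) = (a * b) (V (u ξ)) := congrArg a (hU b hb ξ)
      _ = B (a (b (V ξ))) := (hU (a * b) (mul_mem ha hb) ξ).symm
  have hBB : B† ∘L B = 1 := (ContinuousLinearMap.norm_map_iff_adjoint_comp_self B).1 U.norm_map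
  have hBadjV : B† ∘L V = V ∘L u† :=
    calc B† ∘L V = B† ∘L V ∘L (u * star u) := by rw [Unitary.mul_star_self_of_mem hu]; rfl
      _ = B† ∘L (V ∘L u) ∘L u† := rfl
      _ = (B† ∘L B) ∘L V ∘L u† := by rw [← hBV]; rfl
      _ = V ∘L u† := by rw [hBB]; rfl
  have hVB : V† ∘L B = u ∘L V† := by
    simpa only [ContinuousLinearMap.adjoint_comp, ContinuousLinearMap.adjoint_adjoint] using
      congrArg (·†) hBadjV
  exact ⟨B, hcentral, hBV, hVB⟩

end IsCyclicMap

variable [CompleteSpace H]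

/-- The operators `B ∈ 𝒜'` that lift some `u ∈ ℳ'` along `V`: `B V = V u` and `V* B = u V*`. -/
def commutantLifts (ℳ : VonNeumannAlgebra H) (𝒜 : StarSubalgebra ℂ (K →L[ℂ] K)) (V : H →L[ℂ] K) :
    Set (K →L[ℂ] K) :=
  {B | B ∈ (𝒜 : Set (K →L[ℂ] K)).centralizer ∧
    ∃ u ∈ ℳ.commutant, B ∘L V = V ∘L u ∧ V† ∘L B = u ∘L V†}

/-- The operators `R ∈ 𝒜'` for which every compression `V* R a V` with `a ∈ 𝒜` lies in `ℳ`. -/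
def compressionCommutant (ℳ : VonNeumannAlgebra H) (𝒜 : StarSubalgebra ℂ (K →L[ℂ] K))
    (V : H →L[ℂ] K) : Set (K →L[ℂ] K) :=
  {R | R ∈ (𝒜 : Set (K →L[ℂ] K)).centralizer ∧ ∀ a ∈ 𝒜, V† ∘L R ∘L a ∘L V ∈ ℳ}

theorem star_mem_commutantLifts {ℳ : VonNeumannAlgebra H} {B : K →L[ℂ] K}
    (hB : B ∈ commutantLifts ℳ 𝒜 V) : star B ∈ commutantLifts ℳ 𝒜 V := by
  obtain ⟨hcentral, u, hu, hBV, hVB⟩ := hB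
  refine ⟨Set.star_mem_centralizer' (fun _ => star_mem) hcentral, star u, star_mem hu, ?_, ?_⟩
  · simpa only [ContinuousLinearMap.adjoint_comp, ContinuousLinearMap.adjoint_adjoint,
      ContinuousLinearMap.star_eq_adjoint] using congrArg (·†) hVB
  · simpa only [ContinuousLinearMap.adjoint_comp, ContinuousLinearMap.star_eq_adjoint] using
      congrArg (·†) hBV

theorem IsCyclicMap.centralizer_union_commutantLifts (hV : IsCyclicMap 𝒜 V)
    {ℳ : VonNeumannAlgebra H} (hℳ : ∀ a ∈ 𝒜, V† ∘L a ∘L V ∈ ℳ) :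
    ((𝒜 : Set (K →L[ℂ] K)) ∪ commutantLifts ℳ 𝒜 V).centralizer = compressionCommutant ℳ 𝒜 V := by
  rw [Set.centralizer_union]
  refine Set.Subset.antisymm ?_ ?_
  · rintro R ⟨hR𝒜, hRlifts⟩
    refine ⟨hR𝒜, fun a ha => mem_vonNeumannAlgebra_of_forall_commute_unitary ℳ fun u huℳ hu => ?_⟩
    obtain ⟨B, hB, hBV, hVB⟩ := hV.exists_lift hu fun a ha =>
      (VonNeumannAlgebra.mem_commutant_iff.1 huℳ _ (hℳ a ha)).symm
    calc u ∘L V† ∘L R ∘L a ∘L V = V† ∘L (B * R) ∘L a ∘L V := by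
          rw [← ContinuousLinearMap.comp_assoc u, ← hVB]; rfl
      _ = V† ∘L R ∘L (B * a) ∘L V := by rw [hRlifts B ⟨hB, u, huℳ, hBV, hVB⟩]; rfl
      _ = V† ∘L R ∘L a ∘L V ∘L u := by rw [← hB a ha, ← hBV]; rfl
  · rintro R ⟨hR𝒜, hRℳ⟩
    refine ⟨hR𝒜, fun B ⟨hB𝒜, u, hu, hBV, hVB⟩ => hV.ext_compression fun a ha b hb => ?_⟩
    calc V† ∘L a ∘L (B * R) ∘L b ∘L V = V† ∘L (a * B) ∘L R ∘L b ∘L V := rfl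
      _ = (V† ∘L B) ∘L (a * R) ∘L b ∘L V := by rw [hB𝒜 a ha]; rfl
      _ = u ∘L (V† ∘L R ∘L (a * b) ∘L V) := by rw [hVB, hR𝒜 a ha]; rfl
      _ = (V† ∘L R ∘L (a * b) ∘L V) ∘L u :=
        (VonNeumannAlgebra.mem_commutant_iff.1 hu _ (hRℳ _ (mul_mem ha hb))).symm
      _ = V† ∘L (R * a) ∘L b ∘L V ∘L u := rfl
      _ = V† ∘L a ∘L R ∘L (b * B) ∘L V := by rw [← hBV, ← hR𝒜 a ha]; rfl
      _ = V† ∘L a ∘L (R * B) ∘L b ∘L V := by rw [hB𝒜 b hb]; rfl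

theorem IsCyclicMap.exists_vonNeumannAlgebra_coe_eq_compressionCommutant (hV : IsCyclicMap 𝒜 V)
    {ℳ : VonNeumannAlgebra H} (hℳ : ∀ a ∈ 𝒜, V† ∘L a ∘L V ∈ ℳ) :
    ∃ N : VonNeumannAlgebra K, (N : Set (K →L[ℂ] K)) = compressionCommutant ℳ 𝒜 V := by
  rw [← hV.centralizer_union_commutantLifts hℳ]
  exact exists_vonNeumannAlgebra_coe_eq_centralizer fun B hB =>
    hB.imp star_mem star_mem_commutantLifts

end CyclicMap

section Stinespring

variable {𝒳 : Type*} [CStarAlgebra 𝒳] [PartialOrder 𝒳] [StarOrderedRing 𝒳]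
  {H : Type*} [NormedAddCommGroup H] [InnerProductSpace ℂ H] [CompleteSpace H]
  {K : Type*} [NormedAddCommGroup K] [InnerProductSpace ℂ K] [CompleteSpace K]
  {π : 𝒳 →⋆ₐ[ℂ] (K →L[ℂ] K)} {V : H →L[ℂ] K}

theorem IsMinimalStinespring.isCyclicMap {T : 𝒳 →CP (H →L[ℂ] H)}
    (hπV : IsMinimalStinespring T π V) : IsCyclicMap π.range V := by
  have hrange : (Set.range fun p : π.range × H => (p.1 : K →L[ℂ] K) (V p.2)) =
      {k : K | ∃ (x : 𝒳) (h : H), k = π x (V h)} := by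
    ext k
    constructor
    · rintro ⟨⟨⟨_, x, rfl⟩, ξ⟩, rfl⟩
      exact ⟨x, ξ, rfl⟩
    · rintro ⟨x, ξ, rfl⟩
      exact ⟨(⟨π x, x, rfl⟩, ξ), rfl⟩
  rw [IsCyclicMap, hrange]
  exact Submodule.dense_iff_topologicalClosure_eq_top.2 hπV.dense_span

theorem relativeEffects_eq_effects_compressionCommutant (ℳ : VonNeumannAlgebra H) :
    relativeEffects ℳ π V = {R | R ∈ compressionCommutant ℳ π.range V ∧ 0 ≤ R ∧ R ≤ 1} := by
  have hrange : (π.range : Set (K →L[ℂ] K)) = Set.range π := rfl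
  ext R
  constructor
  · rintro ⟨hR, hR0, hR1, T', hT', hT'R⟩
    refine ⟨⟨hrange ▸ hR, ?_⟩, hR0, hR1⟩
    rintro _ ⟨x, rfl⟩
    exact hT'R x ▸ hT' x
  · rintro ⟨⟨hR, hRℳ⟩, hR0, hR1⟩
    have hR' := hrange ▸ hR
    obtain ⟨T', hT'⟩ := exists_completelyPositive_eq_of_mem_centralizer π V hR' hR0
    exact ⟨hR', hR0, hR1, T', fun x => hT' x ▸ hRℳ (π x) ⟨x, rfl⟩, hT'⟩

end Stinespring

theorem mainTheorem9 {𝒳 : Type*} [CStarAlgebra 𝒳] [PartialOrder 𝒳] [StarOrderedRing 𝒳]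
    {H : Type*} [NormedAddCommGroup H] [InnerProductSpace ℂ H] [CompleteSpace H]
    (ℳ : VonNeumannAlgebra H) (T : 𝒳 →CP (H →L[ℂ] H)) (hT : T ∈ CPMapsInto 𝒳 ℳ)
    {K : Type*} [NormedAddCommGroup K] [InnerProductSpace ℂ K] [CompleteSpace K]
    (π : 𝒳 →⋆ₐ[ℂ] (K →L[ℂ] K)) (V : H →L[ℂ] K) (hπV : IsMinimalStinespring T π V) :
    ∃ N : VonNeumannAlgebra K, (N : Set (K →L[ℂ] K)) = relativeCommutant ℳ π V := by
  have hcompression : ∀ a ∈ π.range, V† ∘L a ∘L V ∈ ℳ := by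
    rintro _ ⟨x, rfl⟩
    exact hπV.map_eq x ▸ hT x
  obtain ⟨N, hN⟩ :=
    hπV.isCyclicMap.exists_vonNeumannAlgebra_coe_eq_compressionCommutant hcompression
  have heffects : relativeEffects ℳ π V = {R | R ∈ N ∧ 0 ≤ R ∧ R ≤ 1} := by
    rw [relativeEffects_eq_effects_compressionCommutant, ← hN]
    rfl
  refine ⟨N, ?_⟩
  rw [relativeCommutant, heffects, closure_sigmaWeakTopology_span_effects]
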